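/- Let $p,q\in(1,\infty)$, let $X$ be a Banach space which is sphere equivalent to some uniformly convex Banach space $Y$ (that is, there is a bijection between the unit spheres of $X$ and $Y$ which is uniformly continuous together with its inverse), and let $\{G_n\}_{n\in\mathbb N}$ be a sequence of finite connected undirected graphs, possibly with multiple edges and self-loops. Then $\{G_n\}_n$ is a family of $(X,p)$-anders if and only if it is a family of $(X,q)$-anders. Here, for a finite connected graph $G$ with vertex set $V$ and set $E$ of oriented edges, and for $r\in[1,\infty)$, the $(X,r)$-spectral gap is \[ \lambda_1(G;X,r):=\frac12\inf_{f}\frac{\sum_{v\in V}\sum_{e=(v,w)\in E}\|f(w)-f(v)\|^r}{\sum_{v\in V}\|f(v)-m(f)\|^r},\qquad m(f):=\frac1{|V|}\sum_{v\in V}f(v), \] where $f$ runs over all nonconstant maps $V\to X$ (the infimum over the empty set being $+\infty$). The sequence $\{G_n\}_n$ is a family of $(X,r)$-anders if the maximal degrees of the $G_n$ are uniformly bounded, $\lim_{n\to\infty}\operatorname{diam}(G_n)=\infty$ for the path metrics, and $\inf_n\lambda_1(G_n;X,r)>0$. -/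

import Mathlib

open scoped ENNReal

/-- A finite undirected graph, possibly with multiple edges and self-loops. `E` is the set of
*oriented* edges: each `e : E` goes from `src e` to `tgt e`, and `rev` exchanges an oriented edge
with the same edge in the opposite orientation. (A self-loop may be its own reverse.) -/
structure FiniteMultigraph where
  /-- the vertices -/
  V : Type*
  /-- the oriented edges -/
  E : Type*
  [fintypeV : Fintype V]
  [fintypeE : Fintype E]
  /-- initial vertex of an oriented edge -/
  src : E → V
  /-- terminal vertex of an oriented edge -/
  tgt : E → V
  /-- orientation reversal -/
  rev : E → E
  rev_rev : ∀ e, rev (rev e) = e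
  src_rev : ∀ e, src (rev e) = tgt e

namespace FiniteMultigraph

attribute [instance] FiniteMultigraph.fintypeV FiniteMultigraph.fintypeE

/-- The simple graph obtained by forgetting self-loops and multiplicities. It has the same
paths, hence the same connectedness, path metric and diameter. -/
def toSimpleGraph (G : FiniteMultigraph) : SimpleGraph G.V where
  Adj v w := v ≠ w ∧ ∃ e : G.E, G.src e = v ∧ G.tgt e = w
  symm := ⟨by
    rintro v w ⟨hvw, e, rfl, rfl⟩
    refine ⟨hvw.symm, G.rev e, G.src_rev e, ?_⟩
    rw [← G.src_rev (G.rev e), G.rev_rev]⟩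
  loopless := ⟨fun _ h => h.1 rfl⟩

/-- Connectedness (which includes having at least one vertex). -/
def Connected (G : FiniteMultigraph) : Prop :=
  G.toSimpleGraph.Connected

/-- The diameter for the path metric. -/
noncomputable def diam (G : FiniteMultigraph) : ℕ :=
  G.toSimpleGraph.diam

open Classical in
/-- The oriented edges that start at `v`. -/
noncomputable def edgesFrom (G : FiniteMultigraph) (v : G.V) : Finset G.E :=
  Finset.univ.filter fun e => G.src e = v

/-- The degree of a vertex: the number of oriented edges that start there. -/
noncomputable def degree (G : FiniteMultigraph) (v : G.V) : ℕ :=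
  (G.edgesFrom v).card

/-- The maximal degree `Δ(G)`. -/
noncomputable def maxDegree (G : FiniteMultigraph) : ℕ :=
  Finset.univ.sup G.degree

/-- The mean `m(f)` of a vector-valued function on the vertices. -/
noncomputable def mean (G : FiniteMultigraph) {X : Type*} [NormedAddCommGroup X]
    [NormedSpace ℝ X] (f : G.V → X) : X :=
  (Fintype.card G.V : ℝ)⁻¹ • ∑ v, f v

/-- The quotient whose infimum defines the Banach spectral gap. Its denominator is positive
when `f` is nonconstant. -/
noncomputable def gapQuotient (G : FiniteMultigraph) {X : Type*} [NormedAddCommGroup X]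
    [NormedSpace ℝ X] (p : ℝ) (f : G.V → X) : ℝ :=
  (∑ v, ∑ e ∈ G.edgesFrom v, ‖f (G.tgt e) - f v‖ ^ p) / ∑ v, ‖f v - G.mean f‖ ^ p

/-- The Banach spectral gap `λ₁(G; X, p)`. The infimum runs over all nonconstant maps `f`; it is
taken in `[0, ∞]`, so that it is `∞` if there is no nonconstant map. -/
noncomputable def spectralGap (G : FiniteMultigraph) (X : Type*) [NormedAddCommGroup X]
    [NormedSpace ℝ X] (p : ℝ) : ℝ≥0∞ :=
  (1 / 2) * ⨅ (f : G.V → X) (_ : ∃ v w, f v ≠ f w), ENNReal.ofReal (G.gapQuotient p f)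

end FiniteMultigraph

/-- A sequence of (finite, connected) graphs is a family of `(X, p)`-anders if its degrees are
bounded, its diameters tend to infinity, and its `(X, p)`-spectral gaps are bounded away
from `0`. -/
def IsAnderFamily (X : Type*) [NormedAddCommGroup X] [NormedSpace ℝ X] (p : ℝ)
    (G : ℕ → FiniteMultigraph) : Prop :=
  BddAbove (Set.range fun n => (G n).maxDegree) ∧
    Filter.Tendsto (fun n => (G n).diam) Filter.atTop Filter.atTop ∧
    0 < ⨅ n, (G n).spectralGap X p

/-- `X` and `Y` are sphere equivalent: there is a uniform homeomorphism between the two unit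
spheres. -/
def SphereEquivalent (X Y : Type*) [NormedAddCommGroup X] [NormedAddCommGroup Y] : Prop :=
  Nonempty (Metric.sphere (0 : X) 1 ≃ᵤ Metric.sphere (0 : Y) 1)

/-! Only the spectral gap depends on the exponent, so the point is to turn a Poincaré inequality for
`q` into one for `p`, with a constant depending only on the exponents, the degree bound and the old
constant (`exists_poincare_of_poincare`). Centre `f` and put `g = radialPower (p / q) ∘ f`. Then
`‖g‖ ^ q = ‖f‖ ^ p` pointwise, and `radialPower (q / p)` recovers `f`. The map is controlled in both
directions by `exists_norm_radialPower_sub_rpow_le`: an arbitrarily small multiple of the norms plus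
a large multiple of the distance. Applied to the inverse, it bounds `S = ∑ ‖f‖ ^ p` by the deviation
of `g` from its mean; Poincaré for `g` passes to its edge differences; applied forwards, it passes
to those of `f`. The small terms are multiples of `S` (by Jensen and the degree bound) and are
absorbed on the left. -/

/-! ### Radial power maps on a normed space -/

section RadialPower

variable {X : Type*} [NormedAddCommGroup X] [NormedSpace ℝ X]

/-- The Mazur-type map that keeps the direction of a vector and raises its norm to the
power `a`. -/
noncomputable def radialPower (a : ℝ) (x : X) : X := ‖x‖ ^ (a - 1) • x

theorem norm_radialPower {a : ℝ} (ha : 0 < a) (x : X) : ‖radialPower a x‖ = ‖x‖ ^ a := by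
  rcases eq_or_ne x 0 with rfl | hx
  · simp [radialPower, Real.zero_rpow ha.ne']
  · have hx' : 0 < ‖x‖ := norm_pos_iff.2 hx
    rw [radialPower, norm_smul, Real.norm_of_nonneg (by positivity), Real.rpow_sub_one hx'.ne']
    field_simp

theorem radialPower_radialPower {a b : ℝ} (ha : 0 < a) (hab : a * b = 1) (x : X) :
    radialPower b (radialPower a x) = x := by
  rcases eq_or_ne x 0 with rfl | hx
  · simp [radialPower]
  · have hx' : 0 < ‖x‖ := norm_pos_iff.2 hx
    rw [radialPower, norm_radialPower ha, radialPower, smul_smul, ← Real.rpow_mul hx'.le,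
      ← Real.rpow_add hx', show a * (b - 1) + (a - 1) = 0 by linear_combination hab,
      Real.rpow_zero, one_smul]

theorem norm_radialPower_sub_le_add {a : ℝ} (x y : X) :
    ‖radialPower a x - radialPower a y‖ ≤
      ‖x‖ ^ (a - 1) * ‖x - y‖ + |‖x‖ ^ (a - 1) - ‖y‖ ^ (a - 1)| * ‖y‖ := by
  have h : radialPower a x - radialPower a y =
      ‖x‖ ^ (a - 1) • (x - y) + (‖x‖ ^ (a - 1) - ‖y‖ ^ (a - 1)) • y := by
    simp only [radialPower, smul_sub, sub_smul]; abel
  rw [h]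
  refine (norm_add_le _ _).trans_eq ?_
  rw [norm_smul, norm_smul, Real.norm_of_nonneg (by positivity), Real.norm_eq_abs]

/-- For `a ≤ 1` the map `radialPower a` is `a`-Hölder continuous. -/
theorem norm_radialPower_sub_le_of_le_one {a : ℝ} (ha : 0 < a) (ha1 : a ≤ 1) {x y : X}
    (hyx : ‖y‖ ≤ ‖x‖) : ‖radialPower a x - radialPower a y‖ ≤ 4 * ‖x - y‖ ^ a := by
  rcases eq_or_ne x y with rfl | hxy
  · simp [Real.zero_rpow ha.ne']
  have hd : 0 < ‖x - y‖ := norm_pos_iff.2 (sub_ne_zero.2 hxy)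
  have hd2 : ‖x - y‖ ≤ 2 * ‖x‖ := (norm_sub_le x y).trans (by linarith)
  have hst : ‖x‖ - ‖y‖ ≤ ‖x - y‖ := norm_sub_norm_le x y
  have hs : 0 < ‖x‖ := by linarith
  have h2 : |‖x‖ ^ (a - 1) - ‖y‖ ^ (a - 1)| * ‖y‖ ≤ ‖x‖ ^ (a - 1) * ‖x - y‖ := by
    rcases (norm_nonneg y).eq_or_lt with ht | ht
    · rw [← ht, mul_zero]; positivity
    have h3 : ‖x‖ ^ (a - 1) ≤ ‖y‖ ^ (a - 1) :=
      Real.rpow_le_rpow_of_nonpos ht hyx (by linarith)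
    rw [abs_of_nonpos (by linarith)]
    have h4 : ‖y‖ ^ (a - 1) * ‖y‖ = ‖y‖ ^ a := by
      rw [Real.rpow_sub_one ht.ne']; field_simp
    have h5 : ‖x‖ ^ (a - 1) * ‖x‖ = ‖x‖ ^ a := by
      rw [Real.rpow_sub_one hs.ne']; field_simp
    have h6 : ‖y‖ ^ a ≤ ‖x‖ ^ a := Real.rpow_le_rpow ht.le hyx ha.le
    have h7 : ‖x‖ ^ (a - 1) * (‖x‖ - ‖y‖) ≤ ‖x‖ ^ (a - 1) * ‖x - y‖ := by gcongr
    linarith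
  -- The exponent is nonpositive, so `‖x - y‖ ≤ 2 * ‖x‖` reverses. Each of the two terms is then at
  -- most `2 * ‖x - y‖ ^ a`.
  have h8 : ‖x‖ ^ (a - 1) ≤ (‖x - y‖ / 2) ^ (a - 1) :=
    Real.rpow_le_rpow_of_nonpos (by positivity) (by linarith) (by linarith)
  have h9 : (‖x - y‖ / 2) ^ (a - 1) * ‖x - y‖ ≤ 2 * ‖x - y‖ ^ a := by
    have h10 : (2 : ℝ)⁻¹ ≤ 2 ^ (a - 1) := by
      rw [← Real.rpow_neg_one]
      exact Real.rpow_le_rpow_of_exponent_le (by norm_num) (by linarith)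
    rw [Real.div_rpow hd.le (by norm_num), div_mul_eq_mul_div, div_le_iff₀ (by positivity),
      Real.rpow_sub_one hd.ne', div_mul_cancel₀ _ hd.ne']
    nlinarith [Real.rpow_pos_of_pos hd a]
  have h11 : ‖x‖ ^ (a - 1) * ‖x - y‖ ≤ (‖x - y‖ / 2) ^ (a - 1) * ‖x - y‖ := by gcongr
  linarith [norm_radialPower_sub_le_add (a := a) x y]

/-- For `1 ≤ a` the map `radialPower a` is Lipschitz on balls. -/
theorem norm_radialPower_sub_le_of_one_le {a : ℝ} (ha : 1 ≤ a) {x y : X} (hyx : ‖y‖ ≤ ‖x‖) :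
    ‖radialPower a x - radialPower a y‖ ≤ (1 + a) * (‖x‖ ^ (a - 1) * ‖x - y‖) := by
  rcases (norm_nonneg x).eq_or_lt with hs | hs
  · rw [norm_eq_zero.1 hs.symm, norm_eq_zero.1 (le_antisymm (hyx.trans hs.symm.le) (norm_nonneg y))]
    simp
  have hst : ‖x‖ - ‖y‖ ≤ ‖x - y‖ := norm_sub_norm_le x y
  have h1 : ‖y‖ ^ (a - 1) ≤ ‖x‖ ^ (a - 1) :=
    Real.rpow_le_rpow (norm_nonneg y) hyx (by linarith)
  -- Bernoulli's inequality: the tangent line at `‖x‖` lies below `t ^ a`.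
  have hb : 1 + a * (‖y‖ / ‖x‖ - 1) ≤ (‖y‖ / ‖x‖) ^ a := by
    simpa using one_add_mul_self_le_rpow_one_add
      (s := ‖y‖ / ‖x‖ - 1) (by linarith [div_nonneg (norm_nonneg y) hs.le]) ha
  rw [Real.div_rpow (norm_nonneg y) hs.le, le_div_iff₀ (by positivity)] at hb
  have h4 : ‖y‖ ^ (a - 1) * ‖y‖ = ‖y‖ ^ a := by
    rcases (norm_nonneg y).eq_or_lt with ht | ht
    · rw [← ht, mul_zero, Real.zero_rpow (by linarith)]
    · rw [Real.rpow_sub_one ht.ne']; field_simp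
  have h5 : ‖x‖ ^ a = ‖x‖ ^ (a - 1) * ‖x‖ := by
    rw [Real.rpow_sub_one hs.ne']; field_simp
  have h6 : (1 + a * (‖y‖ / ‖x‖ - 1)) * ‖x‖ ^ a =
      ‖x‖ ^ (a - 1) * ‖x‖ - a * (‖x‖ ^ (a - 1) * (‖x‖ - ‖y‖)) := by
    rw [h5]; field_simp; ring
  have h7 : ‖x‖ ^ (a - 1) * (‖x‖ - ‖y‖) ≤ ‖x‖ ^ (a - 1) * ‖x - y‖ := by gcongr
  have h8 : a * (‖x‖ ^ (a - 1) * (‖x‖ - ‖y‖)) ≤ a * (‖x‖ ^ (a - 1) * ‖x - y‖) := by gcongr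
  have h9 : ‖x‖ ^ (a - 1) * ‖y‖ ≤ ‖x‖ ^ (a - 1) * ‖x‖ := by gcongr
  have h := norm_radialPower_sub_le_add (a := a) x y
  rw [abs_of_nonneg (by linarith)] at h
  linarith

/-- A quantitative form of the uniform continuity of `radialPower (p / q)` as a map from `ℓ_p`
to `ℓ_q`, which can be summed over any index set. -/
theorem exists_norm_radialPower_sub_rpow_le {p q η : ℝ} (hp : 0 < p) (hq : 0 < q) (hη : 0 < η) :
    ∃ C : ℝ, 0 < C ∧ ∀ {X : Type*} [NormedAddCommGroup X] [NormedSpace ℝ X] (x y : X),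
      ‖radialPower (p / q) x - radialPower (p / q) y‖ ^ q ≤
        η * (‖x‖ ^ p + ‖y‖ ^ p) + C * ‖x - y‖ ^ p := by
  have hpq : 0 < p / q := div_pos hp hq
  suffices h : ∃ C : ℝ, 0 < C ∧ ∀ {X : Type _} [NormedAddCommGroup X] [NormedSpace ℝ X] (x y : X),
      ‖y‖ ≤ ‖x‖ → ‖radialPower (p / q) x - radialPower (p / q) y‖ ^ q ≤
        η * (‖x‖ ^ p + ‖y‖ ^ p) + C * ‖x - y‖ ^ p by
    obtain ⟨C, hC, h⟩ := h
    refine ⟨C, hC, fun x y => ?_⟩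
    rcases le_total ‖y‖ ‖x‖ with hyx | hxy
    · exact h x y hyx
    · have := h y x hxy
      rwa [norm_sub_rev, norm_sub_rev y x, add_comm (‖y‖ ^ p)] at this
  have hpow : ∀ s : ℝ, 0 ≤ s → (s ^ (p / q)) ^ q = s ^ p := fun s hs => by
    rw [← Real.rpow_mul hs, div_mul_cancel₀ _ hq.ne']
  rcases le_total (p / q) 1 with h1 | h1
  · refine ⟨4 ^ q, by positivity, fun x y hyx => ?_⟩
    have h := Real.rpow_le_rpow (norm_nonneg _)
      (norm_radialPower_sub_le_of_le_one hpq h1 hyx) hq.le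
    rw [Real.mul_rpow (by norm_num) (by positivity), hpow _ (norm_nonneg _)] at h
    have : 0 ≤ η * (‖x‖ ^ p + ‖y‖ ^ p) := by positivity
    linarith
  · set a := p / q with ha
    -- The threshold between two regimes: if `‖x - y‖ ≤ ε * ‖x‖`, the Lipschitz bound is at most `η
    -- * ‖x‖ ^ p`; otherwise `‖x‖` is controlled by `‖x - y‖`, which gives a Hölder bound.
    obtain ⟨ε, hε, hεη⟩ : ∃ ε : ℝ, 0 < ε ∧ ((1 + a) * ε) ^ q = η :=
      ⟨η ^ q⁻¹ / (1 + a), by positivity, by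
        rw [mul_div_cancel₀ _ (by positivity), ← Real.rpow_mul hη.le, inv_mul_cancel₀ hq.ne',
          Real.rpow_one]⟩
    refine ⟨((1 + a) * ε⁻¹ ^ (a - 1)) ^ q, by positivity, fun x y hyx => ?_⟩
    have h := norm_radialPower_sub_le_of_one_le h1 hyx
    rcases le_or_gt ‖x - y‖ (ε * ‖x‖) with hd | hd
    · have h2 : (1 + a) * (‖x‖ ^ (a - 1) * ‖x - y‖) ≤ (1 + a) * ε * ‖x‖ ^ a := by
        have h5 : ‖x‖ ^ (a - 1) * ‖x‖ = ‖x‖ ^ a := by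
          rcases (norm_nonneg x).eq_or_lt with hs | hs
          · rw [← hs, mul_zero, Real.zero_rpow hpq.ne']
          · rw [Real.rpow_sub_one hs.ne']; field_simp
        calc _ ≤ (1 + a) * (‖x‖ ^ (a - 1) * (ε * ‖x‖)) := by gcongr
          _ = _ := by rw [← h5]; ring
      have h3 := Real.rpow_le_rpow (norm_nonneg _) (h.trans h2) hq.le
      rw [Real.mul_rpow (by positivity) (by positivity), hpow _ (norm_nonneg _), hεη] at h3
      have h4 : 0 ≤ η * ‖y‖ ^ p := by positivity
      have h5 : 0 ≤ ((1 + a) * ε⁻¹ ^ (a - 1)) ^ q * ‖x - y‖ ^ p := by positivity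
      linarith
    · have hd0 : 0 < ‖x - y‖ := lt_of_le_of_lt (by positivity) hd
      have h2 : (1 + a) * (‖x‖ ^ (a - 1) * ‖x - y‖) ≤
          (1 + a) * ε⁻¹ ^ (a - 1) * ‖x - y‖ ^ a := by
        have h3 : ‖x‖ ≤ ε⁻¹ * ‖x - y‖ := by
          rw [inv_mul_eq_div, le_div_iff₀ hε]; linarith
        have h4 : ‖x‖ ^ (a - 1) ≤ ε⁻¹ ^ (a - 1) * ‖x - y‖ ^ (a - 1) := by
          rw [← Real.mul_rpow (by positivity) (by positivity)]
          exact Real.rpow_le_rpow (norm_nonneg x) h3 (by linarith)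
        calc _ ≤ (1 + a) * (ε⁻¹ ^ (a - 1) * ‖x - y‖ ^ (a - 1) * ‖x - y‖) := by gcongr
          _ = _ := by rw [Real.rpow_sub_one hd0.ne']; field_simp
      have h3 := Real.rpow_le_rpow (norm_nonneg _) (h.trans h2) hq.le
      rw [Real.mul_rpow (by positivity) (by positivity), hpow _ (norm_nonneg _)] at h3
      have : 0 ≤ η * (‖x‖ ^ p + ‖y‖ ^ p) := by positivity
      linarith

end RadialPower

/-! ### Poincaré inequalities and spectral gaps of multigraphs -/

namespace FiniteMultigraph

variable (G : FiniteMultigraph) {X : Type*} [NormedAddCommGroup X] [NormedSpace ℝ X]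

theorem sum_sum_edgesFrom (φ : G.V → G.E → ℝ) :
    ∑ v, ∑ e ∈ G.edgesFrom v, φ v e = ∑ e, φ (G.src e) e := by
  classical
  rw [← Finset.sum_fiberwise Finset.univ G.src]
  refine Finset.sum_congr rfl fun v _ => ?_
  unfold edgesFrom
  refine Finset.sum_congr (by ext; simp) fun e he => ?_
  rw [(Finset.mem_filter.1 he).2]

theorem sum_src_le {D : ℕ} (hD : G.maxDegree ≤ D) {φ : G.V → ℝ} (hφ : ∀ v, 0 ≤ φ v) :
    ∑ e, φ (G.src e) ≤ D * ∑ v, φ v := by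
  rw [← G.sum_sum_edgesFrom fun v _ => φ v, Finset.mul_sum]
  refine Finset.sum_le_sum fun v _ => ?_
  rw [Finset.sum_const, nsmul_eq_mul]
  have h : G.degree v ≤ D := (Finset.le_sup (f := G.degree) (Finset.mem_univ v)).trans hD
  have h' : ((G.edgesFrom v).card : ℝ) ≤ D := by exact_mod_cast h
  exact mul_le_mul_of_nonneg_right h' (hφ v)

theorem sum_tgt (φ : G.V → ℝ) : ∑ e, φ (G.tgt e) = ∑ e, φ (G.src e) :=
  Fintype.sum_equiv ⟨G.rev, G.rev, G.rev_rev, G.rev_rev⟩ _ _ fun e => by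
    simp [G.src_rev]

/-- Jensen's inequality for `t ^ p`, after the triangle inequality. -/
theorem card_mul_norm_mean_rpow_le [Nonempty G.V] {p : ℝ} (hp : 1 ≤ p) (f : G.V → X) :
    Fintype.card G.V * ‖G.mean f‖ ^ p ≤ ∑ v, ‖f v‖ ^ p := by
  have hn : (0 : ℝ) < Fintype.card G.V := by exact_mod_cast Fintype.card_pos
  have h1 : ‖G.mean f‖ ≤ (Fintype.card G.V : ℝ)⁻¹ * ∑ v, ‖f v‖ := by
    rw [mean, norm_smul, Real.norm_of_nonneg (by positivity)]
    gcongr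
    exact norm_sum_le _ _
  have h2 := Real.rpow_sum_le_const_mul_sum_rpow_of_nonneg Finset.univ hp
    (f := fun v => ‖f v‖) fun v _ => norm_nonneg _
  have h3 := Real.rpow_le_rpow (norm_nonneg _) h1 (by linarith : 0 ≤ p)
  rw [Real.mul_rpow (by positivity) (by positivity), Real.inv_rpow hn.le] at h3
  rw [Finset.card_univ, Real.rpow_sub_one hn.ne'] at h2
  have hc : (0 : ℝ) < (Fintype.card G.V : ℝ) ^ p := by positivity
  calc Fintype.card G.V * ‖G.mean f‖ ^ p
      ≤ Fintype.card G.V * (((Fintype.card G.V : ℝ) ^ p)⁻¹ *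
        ((Fintype.card G.V : ℝ) ^ p / Fintype.card G.V * ∑ v, ‖f v‖ ^ p)) := by
        gcongr
        exact h3.trans (by gcongr)
    _ = _ := by field_simp

theorem mean_sub_const [Nonempty G.V] (f : G.V → X) (c : X) :
    G.mean (fun v => f v - c) = G.mean f - c := by
  have hn : (Fintype.card G.V : ℝ) ≠ 0 := by exact_mod_cast Fintype.card_ne_zero
  simp [mean, Finset.sum_sub_distrib, smul_sub, ← Nat.cast_smul_eq_nsmul ℝ, smul_smul]

/-- Up to a factor, the mean is the constant nearest to `f` in `ℓ_p`. -/
theorem sum_norm_sub_mean_rpow_le [Nonempty G.V] {p : ℝ} (hp : 1 ≤ p) (f : G.V → X) (c : X) :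
    ∑ v, ‖f v - G.mean f‖ ^ p ≤ 2 ^ p * ∑ v, ‖f v - c‖ ^ p := by
  have h := G.card_mul_norm_mean_rpow_le hp fun v => f v - c
  rw [mean_sub_const] at h
  have h1 : ∀ v, ‖f v - G.mean f‖ ^ p ≤
      2 ^ (p - 1) * (‖f v - c‖ ^ p + ‖G.mean f - c‖ ^ p) := fun v =>
    (Real.rpow_le_rpow (norm_nonneg _)
      (by simpa using norm_sub_le (f v - c) (G.mean f - c)) (by linarith)).trans
      (mod_cast NNReal.rpow_add_le_mul_rpow_add_rpow ‖f v - c‖₊ ‖G.mean f - c‖₊ hp)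
  calc _ ≤ ∑ v, 2 ^ (p - 1) * (‖f v - c‖ ^ p + ‖G.mean f - c‖ ^ p) :=
        Finset.sum_le_sum fun v _ => h1 v
    _ = 2 ^ (p - 1) * (∑ v, ‖f v - c‖ ^ p + Fintype.card G.V * ‖G.mean f - c‖ ^ p) := by
        rw [← Finset.mul_sum, Finset.sum_add_distrib]; simp
    _ ≤ 2 ^ (p - 1) * (∑ v, ‖f v - c‖ ^ p + ∑ v, ‖f v - c‖ ^ p) := by gcongr
    _ = _ := by rw [Real.rpow_sub_one (by norm_num)]; ring

/-- The `(X, p)`-Poincaré inequality with constant `K`. -/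
def Poincare (X : Type*) [NormedAddCommGroup X] [NormedSpace ℝ X] (p K : ℝ) : Prop :=
  ∀ f : G.V → X, ∑ v, ‖f v - G.mean f‖ ^ p ≤ K * ∑ e, ‖f (G.tgt e) - f (G.src e)‖ ^ p

theorem gapQuotient_eq (p : ℝ) (f : G.V → X) :
    G.gapQuotient p f =
      (∑ e, ‖f (G.tgt e) - f (G.src e)‖ ^ p) / ∑ v, ‖f v - G.mean f‖ ^ p := by
  rw [gapQuotient, G.sum_sum_edgesFrom fun v e => ‖f (G.tgt e) - f v‖ ^ p]

theorem sum_norm_sub_mean_rpow_pos {p : ℝ} {f : G.V → X} (hf : ∃ v w, f v ≠ f w) :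
    0 < ∑ v, ‖f v - G.mean f‖ ^ p := by
  obtain ⟨v, w, hvw⟩ := hf
  obtain ⟨u, hu⟩ : ∃ u, f u ≠ G.mean f := by
    by_contra! h
    exact hvw ((h v).trans (h w).symm)
  refine Finset.sum_pos' (fun _ _ => by positivity) ⟨u, Finset.mem_univ u, ?_⟩
  exact Real.rpow_pos_of_pos (norm_pos_iff.2 (sub_ne_zero.2 hu)) p

theorem Poincare.le_spectralGap {p K : ℝ} (hK : 0 < K) (h : G.Poincare X p K) :
    1 / 2 * ENNReal.ofReal K⁻¹ ≤ G.spectralGap X p := by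
  refine mul_le_mul_right (le_iInf₂ fun f hf => ENNReal.ofReal_le_ofReal ?_) _
  rw [gapQuotient_eq, le_div_iff₀ (G.sum_norm_sub_mean_rpow_pos hf), inv_mul_le_iff₀ hK]
  exact h f

theorem poincare_of_le_spectralGap [Nonempty G.V] {p ε : ℝ} (hp : 0 < p) (hε : 0 < ε)
    (h : ENNReal.ofReal ε ≤ G.spectralGap X p) : G.Poincare X p ε⁻¹ := by
  intro f
  by_cases hf : ∃ v w, f v ≠ f w
  · have h1 : ENNReal.ofReal ε ≤ ENNReal.ofReal (G.gapQuotient p f) :=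
      calc ENNReal.ofReal ε ≤ G.spectralGap X p := h
        -- The factor `1 / 2` is simply bounded by `1`, as the sharp constant is irrelevant.
        _ ≤ 1 * ⨅ (f : G.V → X) (_ : ∃ v w, f v ≠ f w), ENNReal.ofReal (G.gapQuotient p f) :=
          mul_le_mul_left (by simp) _
        _ ≤ _ := by rw [one_mul]; exact iInf₂_le f hf
    have h2 : ε ≤ G.gapQuotient p f := by
      by_contra! hlt
      exact absurd h1 (not_le.2 ((ENNReal.ofReal_lt_ofReal_iff hε).2 hlt))
    rw [gapQuotient_eq, le_div_iff₀ (G.sum_norm_sub_mean_rpow_pos hf)] at h2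
    rwa [inv_mul_eq_div, le_div_iff₀ hε, mul_comm]
  · push Not at hf
    obtain ⟨v₀⟩ := ‹Nonempty G.V›
    have hn : (Fintype.card G.V : ℝ) ≠ 0 := by
      exact_mod_cast (Fintype.card_pos_iff.2 ⟨v₀⟩).ne'
    have hm : ∀ v, f v = G.mean f := fun v => by
      rw [mean, Finset.sum_congr rfl fun w _ => hf w v]
      simp [← Nat.cast_smul_eq_nsmul ℝ, smul_smul]
    have h0 : ∑ v, ‖f v - G.mean f‖ ^ p = 0 :=
      Finset.sum_eq_zero fun v _ => by rw [← hm v, sub_self, norm_zero, Real.zero_rpow hp.ne']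
    rw [h0]
    positivity

/-- Matoušek's extrapolation for maps into an arbitrary normed space: a Poincaré inequality for
the exponent `q` gives one for `p`, with a constant that depends only on the exponents, the
degree and the original constant. -/
theorem exists_poincare_of_poincare {p q K : ℝ} (hp : 1 ≤ p) (hq : 1 ≤ q) (hK : 0 < K) (D : ℕ) :
    ∃ K' : ℝ, 0 < K' ∧ ∀ (G : FiniteMultigraph) {X : Type*} [NormedAddCommGroup X]
      [NormedSpace ℝ X], Nonempty G.V → G.maxDegree ≤ D → G.Poincare X q K →
        G.Poincare X p K' := by
  have hp0 : 0 < p := by linarith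
  have hq0 : 0 < q := by linarith
  obtain ⟨A, hA, hinv⟩ := exists_norm_radialPower_sub_rpow_le (η := (4 * 2 ^ p)⁻¹) hq0 hp0
    (by positivity)
  set B : ℝ := 2 * 2 ^ p * A * K with hB
  have hB0 : 0 < B := by positivity
  -- Chosen so that the error `B * η * 2 * D * S` is at most `S / 2`; `D + 1` keeps the denominator
  -- nonzero when `D = 0`.
  obtain ⟨C, hC, hfwd⟩ := exists_norm_radialPower_sub_rpow_le (η := (4 * B * (D + 1))⁻¹) hp0 hq0
    (by positivity)
  refine ⟨2 * B * C, by positivity, fun G X _ _ hne hdeg hG f₀ => ?_⟩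
  set f : G.V → X := fun v => f₀ v - G.mean f₀ with hf
  have hmean : G.mean f = 0 := by rw [hf, mean_sub_const, sub_self]
  have hgrad : ∀ e, f (G.tgt e) - f (G.src e) = f₀ (G.tgt e) - f₀ (G.src e) := fun e => by
    simp [hf]
  change ∑ v, ‖f v‖ ^ p ≤ _
  simp_rw [← hgrad]
  set g : G.V → X := fun v => radialPower (p / q) (f v) with hg
  set S := ∑ v, ‖f v‖ ^ p with hS
  set T := ∑ e, ‖f (G.tgt e) - f (G.src e)‖ ^ p with hT
  have hS0 : 0 ≤ S := Finset.sum_nonneg fun v _ => by positivity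
  have hgf : ∀ v, ‖g v‖ ^ q = ‖f v‖ ^ p := fun v => by
    rw [hg, norm_radialPower (by positivity), ← Real.rpow_mul (norm_nonneg _),
      div_mul_cancel₀ _ hq0.ne']
  have hfg : ∀ v, radialPower (q / p) (g v) = f v := fun v =>
    radialPower_radialPower (by positivity) (by field_simp) _
  have hgS : ∑ v, ‖g v‖ ^ q = S := Finset.sum_congr rfl fun v _ => hgf v
  have hjensen := G.card_mul_norm_mean_rpow_le hq g
  have h1 : S ≤ 2 * 2 ^ p * A * ∑ v, ‖g v - G.mean g‖ ^ q := by
    -- The inverse map need not send the mean of `g` to that of `f`, but comparing `f` with any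
    -- constant costs only a factor `2 ^ p`.
    have h2 := G.sum_norm_sub_mean_rpow_le hp f (radialPower (q / p) (G.mean g))
    simp_rw [hmean, sub_zero] at h2
    have h3 : ∑ v, ‖f v - radialPower (q / p) (G.mean g)‖ ^ p ≤
        (4 * 2 ^ p)⁻¹ * (∑ v, ‖g v‖ ^ q + Fintype.card G.V * ‖G.mean g‖ ^ q) +
          A * ∑ v, ‖g v - G.mean g‖ ^ q := by
      calc _ ≤ ∑ v, ((4 * 2 ^ p)⁻¹ * (‖g v‖ ^ q + ‖G.mean g‖ ^ q) +
            A * ‖g v - G.mean g‖ ^ q) := Finset.sum_le_sum fun v _ => by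
              simpa only [hfg] using hinv (g v) (G.mean g)
        _ = _ := by
          rw [Finset.sum_add_distrib, ← Finset.mul_sum, ← Finset.mul_sum,
            Finset.sum_add_distrib]
          simp
    have h4 : (4 * 2 ^ p)⁻¹ * (∑ v, ‖g v‖ ^ q + Fintype.card G.V * ‖G.mean g‖ ^ q) ≤
        (4 * 2 ^ p)⁻¹ * (S + S) := by
      gcongr
      · exact hgS.le
      · exact hjensen.trans hgS.le
    have h5 : 2 ^ p * ((4 * 2 ^ p)⁻¹ * (S + S)) = S / 2 := by
      have : (2 : ℝ) ^ p ≠ 0 := by positivity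
      field_simp; ring
    have h6 := h2.trans (mul_le_mul_of_nonneg_left
      (h3.trans (add_le_add_left h4 _)) (by positivity : (0 : ℝ) ≤ 2 ^ p))
    rw [mul_add, h5] at h6
    linarith
  have h7 : ∑ e, ‖g (G.tgt e) - g (G.src e)‖ ^ q ≤ (4 * B * (D + 1))⁻¹ * (2 * (D * S)) + C * T := by
    calc _ ≤ ∑ e, ((4 * B * (D + 1))⁻¹ * (‖f (G.tgt e)‖ ^ p + ‖f (G.src e)‖ ^ p) +
            C * ‖f (G.tgt e) - f (G.src e)‖ ^ p) := Finset.sum_le_sum fun e _ => hfwd _ _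
      _ = (4 * B * (D + 1))⁻¹ * (2 * ∑ e, ‖f (G.src e)‖ ^ p) + C * T := by
          rw [Finset.sum_add_distrib, ← Finset.mul_sum, ← Finset.mul_sum,
            Finset.sum_add_distrib, G.sum_tgt fun v => ‖f v‖ ^ p, two_mul]
      _ ≤ _ := by
          gcongr
          exact G.sum_src_le hdeg (φ := fun v => ‖f v‖ ^ p) fun v => by positivity
  have h8 : S ≤ B * ((4 * B * (D + 1))⁻¹ * (2 * (D * S)) + C * T) :=
    calc S ≤ 2 * 2 ^ p * A * ∑ v, ‖g v - G.mean g‖ ^ q := h1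
      _ ≤ 2 * 2 ^ p * A * (K * ∑ e, ‖g (G.tgt e) - g (G.src e)‖ ^ q) := by
          gcongr
          exact hG g
      _ = B * ∑ e, ‖g (G.tgt e) - g (G.src e)‖ ^ q := by rw [hB]; ring
      _ ≤ _ := by gcongr
  have h9 : B * ((4 * B * (D + 1))⁻¹ * (2 * (D * S))) ≤ S / 2 := by
    have h10 : B * ((4 * B * (D + 1))⁻¹ * (2 * (D * S))) = D / (D + 1) * (S / 2) := by
      field_simp; ring
    rw [h10]
    exact mul_le_of_le_one_left (by positivity)
      ((div_le_one (by positivity)).2 (by linarith))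
  linarith

end FiniteMultigraph

/-! ### Families of anders -/

theorem iInf_spectralGap_pos_iff {X : Type*} [NormedAddCommGroup X] [NormedSpace ℝ X] {p : ℝ}
    (hp : 0 < p) (G : ℕ → FiniteMultigraph) (hG : ∀ n, Nonempty (G n).V) :
    0 < ⨅ n, (G n).spectralGap X p ↔ ∃ K : ℝ, 0 < K ∧ ∀ n, (G n).Poincare X p K := by
  constructor
  · intro h
    obtain ⟨ε, hε, hlt⟩ := ENNReal.lt_iff_exists_nnreal_btwn.1 h
    have hε' : (0 : ℝ) < ε := by exact_mod_cast hε
    refine ⟨(ε : ℝ)⁻¹, by positivity, fun n => ?_⟩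
    have := hG n
    refine (G n).poincare_of_le_spectralGap hp hε' ?_
    rw [ENNReal.ofReal_coe_nnreal]
    exact hlt.le.trans (iInf_le _ n)
  · rintro ⟨K, hK, h⟩
    refine lt_of_lt_of_le ?_ (le_iInf fun n => (h n).le_spectralGap (G n) hK)
    exact ENNReal.mul_pos (by simp) (ENNReal.ofReal_pos.2 (by positivity)).ne'

/-- Passing from one exponent to another; no assumption on the normed space is needed. -/
theorem IsAnderFamily.of_exponent {p q : ℝ} (hp : 1 ≤ p) (hq : 1 ≤ q)
    {X : Type*} [NormedAddCommGroup X] [NormedSpace ℝ X]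
    {G : ℕ → FiniteMultigraph} (hG : ∀ n, (G n).Connected) (h : IsAnderFamily X q G) :
    IsAnderFamily X p G := by
  have hne : ∀ n, Nonempty (G n).V := fun n => (hG n).nonempty
  obtain ⟨⟨D, hD⟩, hdiam, hgap⟩ := h
  obtain ⟨K, hK, hPoinc⟩ := (iInf_spectralGap_pos_iff (by linarith) G hne).1 hgap
  obtain ⟨K', hK', hK''⟩ := FiniteMultigraph.exists_poincare_of_poincare hp hq hK D
  exact ⟨⟨D, hD⟩, hdiam, (iInf_spectralGap_pos_iff (by linarith) G hne).2
    ⟨K', hK', fun n => hK'' (G n) (hne n) (hD ⟨n, rfl⟩) (hPoinc n)⟩⟩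

theorem theoremB {p q : ℝ} (hp : 1 < p) (hq : 1 < q)
    {X : Type*} [NormedAddCommGroup X] [NormedSpace ℝ X] [CompleteSpace X]
    {Y : Type*} [NormedAddCommGroup Y] [NormedSpace ℝ Y] [CompleteSpace Y]
    [UniformConvexSpace Y] (hXY : SphereEquivalent X Y)
    (G : ℕ → FiniteMultigraph) (hG : ∀ n, (G n).Connected) :
    IsAnderFamily X p G ↔ IsAnderFamily X q G :=
  ⟨.of_exponent hq.le hp.le hG, .of_exponent hp.le hq.le hG⟩
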